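/- All graphs are finite and simple. For disjoint nonempty vertex sets $A,B$ of a graph let $d(A,B)=e(A,B)/(|A||B|)$, where $e(A,B)$ is the number of edges between $A$ and $B$; the pair $(A,B)$ is $\gamma$-regular if $|d(A',B')-d(A,B)|\le\gamma$ for all $A'\subseteq A$, $B'\subseteq B$ with $|A'|\ge\gamma|A|$ and $|B'|\ge\gamma|B|$. Let $\mathcal F$ be a (possibly infinite) family of graphs. For a graph $G$ on $n\ge 1$ vertices let $E_{\mathcal F}(G)$ be $1/n^2$ times the minimum number of edge additions and deletions that turn $G$ into a graph containing no member of $\mathcal F$ as a (not necessarily induced) subgraph. For a weighted complete graph $W$ on $k\ge 1$ vertices with edge weights $w(i,j)\in[0,1]$ let $\mathcal H_{\mathcal F}(W)$ be $1/k^2$ times the minimum total weight of a set of edges whose removal from the complete graph on the vertices of $W$ leaves a graph to which no member of $\mathcal F$ has a homomorphism. (A minimum over the empty set is $+\infty$.) **Lemma 3.3 (The Key Lemma).** For every family of graphs $\mathcal F$ there are functions $N(k,\epsilon)\in\mathbb N$ and $\gamma(k,\epsilon)>0$, defined for integers $k\ge 1$ and reals $\epsilon>0$, with the following property. Let $W$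 be any weighted complete graph on the vertices $1,\dots,k$ with edge weights $w(i,j)\in[0,1]$, and let $G$ be any $k$-partite graph with partition classes $V_1,\dots,V_k$ such that 1. $|V_1|=\dots=|V_k|\ge N(k,\epsilon)$, where these classes are nonempty; 2. all pairs $(V_i,V_j)$, $1\le i<j\le k$, are $\gamma(k,\epsilon)$-regular; 3. $d(V_i,V_j)=w(i,j)$ for all $1\le i<j\le k$. Then $E_{\mathcal F}(G)\ge\mathcal H_{\mathcal F}(W)-\epsilon$. -/

import Mathlib

open scoped ENNReal

namespace GraphEdit

/-- A (possibly infinite) family of finite simple graphs. Every finite graph is isomorphic to a graph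
on some `Fin m`, and all notions below are invariant under isomorphism. -/
abbrev GraphFamily := Set (Σ m : ℕ, SimpleGraph (Fin m))

/-- `G` contains no member of `F` as a (not necessarily induced) subgraph. -/
def FamilyFree (F : GraphFamily) {V : Type*} (G : SimpleGraph V) : Prop :=
  ∀ H ∈ F, H.2.Free G

/-- There is no homomorphism from any member of `F` to `R`. -/
def HomFree (F : GraphFamily) {V : Type*} (R : SimpleGraph V) : Prop :=
  ∀ H ∈ F, IsEmpty (H.2 →g R)

/-- The edit distance: the least number of edge additions and deletions turning `G` into `G'`,
that is, the number of edges in exactly one of the two graphs. -/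
noncomputable def editDist {V : Type*} (G G' : SimpleGraph V) : ℕ :=
  (symmDiff G.edgeSet G'.edgeSet).ncard

/-- The normalized edit distance `E_P(G) = min_{G' ∈ P} Δ(G, G') / n ^ 2` of a graph `G` on `n` vertices
from a property `P` (the set of the graphs on the vertex set of `G` that have the property).
It is `∞` if no graph on this vertex set has the property. -/
noncomputable def editE {V : Type*} [Fintype V] (P : Set (SimpleGraph V)) (G : SimpleGraph V) :
    ℝ≥0∞ :=
  ⨅ G' ∈ P, (editDist G G' : ℝ≥0∞) / (Fintype.card V : ℝ≥0∞) ^ 2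

/-- `E_F(G)`: the normalized edit distance of `G` from being `F`-free. -/
noncomputable def familyE (F : GraphFamily) {V : Type*} [Fintype V] (G : SimpleGraph V) : ℝ≥0∞ :=
  editE {G' : SimpleGraph V | FamilyFree F G'} G

/-- A weighted complete graph on the vertices `Fin k`, with edge weights in `[0, 1]`.
The values of `weight` on the diagonal are not edge weights and are never used. -/
structure WeightedCompleteGraph (k : ℕ) where
  weight : Sym2 (Fin k) → ℝ
  weight_mem : ∀ e ∈ (⊤ : SimpleGraph (Fin k)).edgeSet, weight e ∈ Set.Icc (0 : ℝ) 1

/-- `H'_F(W)`: the minimum total weight of a set of edges whose removal from the complete graph makes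
it `F`-homomorphism-free (`∞` if there is no such set of edges). -/
noncomputable def homWeight (F : GraphFamily) {k : ℕ} (W : WeightedCompleteGraph k) : ℝ≥0∞ :=
  ⨅ (S : Finset (Sym2 (Fin k)))
    (_ : (S : Set (Sym2 (Fin k))) ⊆ (⊤ : SimpleGraph (Fin k)).edgeSet)
    (_ : HomFree F ((⊤ : SimpleGraph (Fin k)).deleteEdges (S : Set (Sym2 (Fin k))))),
    ENNReal.ofReal (∑ e ∈ S, W.weight e)

/-- `H_F(W) = H'_F(W) / k ^ 2`. -/
noncomputable def familyH (F : GraphFamily) {k : ℕ} (W : WeightedCompleteGraph k) : ℝ≥0∞ :=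
  homWeight F W / (k : ℝ≥0∞) ^ 2

open Classical in
/-- The edge density `d(A, B) = e(A, B) / (|A| |B|)` of a pair of disjoint nonempty vertex sets. -/
noncomputable def density {V : Type*} (G : SimpleGraph V) (A B : Finset V) : ℝ :=
  (G.edgeDensity A B : ℝ)

/-- The pair `(A, B)` is `γ`-regular in `G`. -/
def IsRegularPair {V : Type*} (G : SimpleGraph V) (γ : ℝ) (A B : Finset V) : Prop :=
  ∀ A' ⊆ A, ∀ B' ⊆ B, γ * (A.card : ℝ) ≤ (A'.card : ℝ) → γ * (B.card : ℝ) ≤ (B'.card : ℝ) →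
    |density G A' B' - density G A B| ≤ γ

/-- The `i`-th partition class of a graph that is `k`-partite through the proper colouring `c`. -/
def part {V : Type*} [Fintype V] {G : SimpleGraph V} {k : ℕ} (c : G.Coloring (Fin k)) (i : Fin k) :
    Finset V :=
  Finset.univ.filter fun v => c v = i

end GraphEdit

/-! Fix an `F`-free graph `G'` and put `Q = G \ G'`. It suffices to bound below the edges of `Q`
between the classes. No regularity lemma is applied to `G'`. Instead, every large box (a choice of
subsets `U i` of the classes) has a sub-box of constant relative size on which `G'` is sparse across
all non-edges of some homomorphism-free `R` on `k` vertices. To find it, start from the complete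
graph as pattern; while some edge of the pattern is not lower-dense, delete it and shrink to a
sparse pair witnessing this. When this stops, greedy embedding places every small graph that maps to
the pattern inside `G'`, so the pattern is homomorphism-free. Regularity keeps the densities of `G`
on the sub-box close to `w`, so the total density of `Q` there is almost the weight of the non-edges
of `R`, which is at least the minimum.

Since `R` varies with the box, these local bounds have to be averaged. A box splits into `2 ^ k`
pieces, one of them the good sub-box, and the others are treated recursively. After `t` rounds the
transversals not yet covered form a fraction at most `(1 - c ^ k) ^ t`. Averaging the number of
`Q`-edges spanned by a transversal then gives the global bound. -/

namespace GraphEdit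

open Finset

/-! ### Edge counts between vertex sets -/

open Classical in
/-- The number of pairs in `X × Y` that are adjacent in `G`. -/
noncomputable def crossing {V : Type*} (G : SimpleGraph V) (X Y : Finset V) : ℕ :=
  #(G.interedges X Y)

theorem crossing_comm {V : Type*} (G : SimpleGraph V) (X Y : Finset V) :
    crossing G X Y = crossing G Y X := by
  classical
  have : Std.Symm G.Adj := G.symm
  unfold crossing SimpleGraph.interedges
  exact Rel.card_interedges_comm X Y

theorem crossing_mono {V : Type*} (G : SimpleGraph V) {X X' Y Y' : Finset V} (hX : X' ⊆ X)
    (hY : Y' ⊆ Y) : crossing G X' Y' ≤ crossing G X Y := by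
  classical
  exact card_le_card (Rel.interedges_mono hX hY)

theorem density_eq_crossing_div {V : Type*} (G : SimpleGraph V) (X Y : Finset V) :
    density G X Y = (crossing G X Y : ℝ) / (#X * #Y) := by
  classical
  simp only [density, crossing, SimpleGraph.edgeDensity_def]
  push_cast
  congr!

open Classical in
theorem crossing_eq_sum_degree {V : Type*} (G : SimpleGraph V) (X Y : Finset V) :
    crossing G X Y = ∑ x ∈ X, #{y ∈ Y | G.Adj x y} := by
  unfold crossing SimpleGraph.interedges Rel.interedges
  rw [card_filter, sum_product]
  simp_rw [card_filter]

/-! ### Lower-dense pairs and greedy embedding -/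

/-- Every pair of subsets of `A` and `B` of relative size at least `α` has density at least `b`. -/
def LowerDense {V : Type*} (G : SimpleGraph V) (α b : ℝ) (A B : Finset V) : Prop :=
  ∀ X ⊆ A, ∀ Y ⊆ B, α * #A ≤ #X → α * #B ≤ #Y → b * (#X * #Y) ≤ crossing G X Y

theorem LowerDense.mono_subset {V : Type*} {G : SimpleGraph V} {α α' b s : ℝ}
    {A B A' B' : Finset V} (h : LowerDense G α b A B) (hα : α ≤ α' * s) (hα' : 0 ≤ α')
    (hA : A' ⊆ A) (hB : B' ⊆ B) (hA' : s * #A ≤ #A') (hB' : s * #B ≤ #B') :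
    LowerDense G α' b A' B' := by
  intro X hX Y hY h1 h2
  refine h X (hX.trans hA) Y (hY.trans hB) ?_ ?_
  · calc α * #A ≤ α' * s * #A := by gcongr
      _ = α' * (s * #A) := by ring
      _ ≤ α' * #A' := by gcongr
      _ ≤ _ := h1
  · calc α * #B ≤ α' * s * #B := by gcongr
      _ = α' * (s * #B) := by ring
      _ ≤ α' * #B' := by gcongr
      _ ≤ _ := h2

-- If the low-degree vertices were too many, then together with all of `B` they would form a pair
-- violating lower density.
open Classical in
theorem LowerDense.card_small_degree_le {V : Type*} {G : SimpleGraph V} {α b : ℝ}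
    {A B : Finset V} (h : LowerDense G α b A B) (hα : α ≤ 1) (hα0 : 0 < α) (hA : A.Nonempty) :
    (#{x ∈ A | (#{y ∈ B | G.Adj x y} : ℝ) < b * #B} : ℝ) ≤ α * #A := by
  by_contra! hlt
  set X := {x ∈ A | (#{y ∈ B | G.Adj x y} : ℝ) < b * #B} with hX
  have h1 := h X (filter_subset _ _) B subset_rfl hlt.le
    (by nlinarith [(Nat.cast_nonneg #B : (0 : ℝ) ≤ #B)])
  have hne : X.Nonempty := by
    rw [← card_pos]
    have : (0 : ℝ) < #X := lt_of_le_of_lt (by positivity) hlt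
    exact_mod_cast this
  rw [crossing_eq_sum_degree] at h1
  push_cast at h1
  have h2 : ∑ x ∈ X, (#{y ∈ B | G.Adj x y} : ℝ) < ∑ x ∈ X, b * #B :=
    sum_lt_sum_of_nonempty hne fun x hx => (mem_filter.1 hx).2
  rw [sum_const, nsmul_eq_mul] at h2
  linarith

/-- Greedy embedding: a graph on few vertices embeds into large candidate sets that are
lower-dense along its edges. -/
theorem exists_embedding {b : ℝ} (hb : 0 < b) (hb1 : b ≤ 1) (M : ℕ) :
    ∃ α : ℝ, 0 < α ∧ α ≤ 1 ∧ ∃ N : ℕ, ∀ (V : Type*) (G : SimpleGraph V) (h : ℕ), h ≤ M →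
      ∀ (H : SimpleGraph (Fin h)) (C : Fin h → Finset V), (∀ x, N ≤ #(C x)) →
        (∀ x y, H.Adj x y → LowerDense G α b (C x) (C y)) →
        ∃ f : Fin h → V, Function.Injective f ∧ (∀ x, f x ∈ C x) ∧
          ∀ x y, H.Adj x y → G.Adj (f x) (f y) := by
  classical
  induction M with
  | zero =>
    refine ⟨1, one_pos, le_rfl, 0, fun V G h hh H C _ _ => ?_⟩
    obtain rfl : h = 0 := by omega
    exact ⟨Fin.elim0, fun x => x.elim0, fun x => x.elim0, fun x => x.elim0⟩
  | succ M ih =>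
    obtain ⟨α, hα, hα1, N, ih⟩ := ih
    have hM : (0 : ℝ) < M + 1 := by positivity
    -- Candidate sets keep a fraction `b / 2`, which accounts for the first bound. The second makes
    -- at most `M` bad sets cover less than half of `C 0`. The size threshold leaves room for
    -- erasing one vertex.
    refine ⟨min (α * (b / 2)) (1 / (M + 1) / 2), by positivity, ?_,
      ⌈(N + 1) * (2 / b)⌉₊ + 1, ?_⟩
    · refine (min_le_left _ _).trans ?_
      nlinarith
    set α' := min (α * (b / 2)) (1 / ((M : ℝ) + 1) / 2) with hα'
    have hα'0 : 0 < α' := by positivity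
    have hα'1 : α' ≤ 1 := (min_le_left _ _).trans (by nlinarith)
    intro V G h hh H C hC hH
    rcases h with _ | h
    · exact ⟨Fin.elim0, fun x => x.elim0, fun x => x.elim0, fun x => x.elim0⟩
    have hCr : ∀ x, (N + 1) * (2 / b) ≤ (#(C x) : ℝ) := fun x => by
      have h1 : ((⌈((N : ℝ) + 1) * (2 / b)⌉₊ + 1 : ℕ) : ℝ) ≤ #(C x) := by exact_mod_cast hC x
      push_cast at h1
      linarith [Nat.le_ceil (((N : ℝ) + 1) * (2 / b))]
    have h0 : (C 0).Nonempty := card_pos.1 (by have := hC 0; omega)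
    have h0' : (0 : ℝ) < #(C 0) := by exact_mod_cast h0.card_pos
    let bad : Fin h → Finset V := fun y =>
      if H.Adj 0 y.succ then {x ∈ C 0 | (#{z ∈ C y.succ | G.Adj x z} : ℝ) < b * #(C y.succ)}
      else ∅
    have hbad : ∀ y, (#(bad y) : ℝ) ≤ α' * #(C 0) := fun y => by
      by_cases hy : H.Adj 0 y.succ
      · simp only [bad, if_pos hy]
        exact (hH _ _ hy).card_small_degree_le hα'1 hα'0 h0
      · simp only [bad, if_neg hy, card_empty, Nat.cast_zero]
        positivity
    have hbadsum : #(univ.biUnion bad) < #(C 0) := by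
      have h1 : (#(univ.biUnion bad) : ℝ) ≤ ∑ y, (#(bad y) : ℝ) := by
        exact_mod_cast card_biUnion_le
      have h2 : ∑ y, (#(bad y) : ℝ) ≤ h * (α' * #(C 0)) := by
        refine (sum_le_sum fun y _ => hbad y).trans ?_
        simp
      have h3 : (h : ℝ) ≤ M := by exact_mod_cast (by omega : h ≤ M)
      have h4 : α' ≤ 1 / (M + 1) / 2 := min_le_right _ _
      have h5 : h * (α' * #(C 0)) ≤ (M + 1) * (1 / (M + 1) / 2 * #(C 0)) := by
        gcongr
        linarith
      have h6 : ((M : ℝ) + 1) * (1 / (M + 1) / 2 * #(C 0)) = #(C 0) / 2 := by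
        field_simp
      have : (#(univ.biUnion bad) : ℝ) < #(C 0) := by linarith
      exact_mod_cast this
    obtain ⟨v, hv, hvb⟩ := exists_mem_notMem_of_card_lt_card hbadsum
    have hdeg : ∀ y : Fin h, H.Adj 0 y.succ →
        b * #(C y.succ) ≤ (#{z ∈ C y.succ | G.Adj v z} : ℝ) := by
      intro y hy
      by_contra! hlt
      refine hvb (mem_biUnion.2 ⟨y, mem_univ _, ?_⟩)
      simp only [bad, if_pos hy, mem_filter]
      exact ⟨hv, hlt⟩
    -- The chosen vertex is erased because candidate sets may overlap or coincide, while the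
    -- embedding must be injective.
    let C' : Fin h → Finset V := fun y =>
      (if H.Adj 0 y.succ then {z ∈ C y.succ | G.Adj v z} else C y.succ).erase v
    have hC's : ∀ y, C' y ⊆ C y.succ := fun y => by
      refine (erase_subset _ _).trans ?_
      split_ifs
      · exact filter_subset _ _
      · exact subset_rfl
    have hC'c : ∀ y, b / 2 * #(C y.succ) ≤ (#(C' y) : ℝ) := fun y => by
      have h1 : (#(if H.Adj 0 y.succ then {z ∈ C y.succ | G.Adj v z} else C y.succ) : ℝ) - 1
          ≤ #(C' y) := by
        have := pred_card_le_card_erase (a := v)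
          (s := if H.Adj 0 y.succ then {z ∈ C y.succ | G.Adj v z} else C y.succ)
        have h2 : #(if H.Adj 0 y.succ then {z ∈ C y.succ | G.Adj v z} else C y.succ)
          ≤ #(C' y) + 1 := by simp only [C']; omega
        have : (#(if H.Adj 0 y.succ then {z ∈ C y.succ | G.Adj v z} else C y.succ) : ℝ)
          ≤ #(C' y) + 1 := by exact_mod_cast h2
        linarith
      have h2 : b * #(C y.succ) ≤
          (#(if H.Adj 0 y.succ then {z ∈ C y.succ | G.Adj v z} else C y.succ) : ℝ) := by
        split_ifs with hy
        · exact hdeg y hy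
        · nlinarith [(Nat.cast_nonneg #(C y.succ) : (0 : ℝ) ≤ #(C y.succ))]
      have h3 : 1 ≤ b / 2 * #(C y.succ) := by
        calc (1 : ℝ) ≤ N + 1 := by linarith [(Nat.cast_nonneg N : (0 : ℝ) ≤ N)]
          _ = b / 2 * ((N + 1) * (2 / b)) := by field_simp
          _ ≤ _ := by gcongr; exact hCr _
      linarith
    have hC'N : ∀ y, N ≤ #(C' y) := fun y => by
      have : (N : ℝ) ≤ #(C' y) := by
        calc (N : ℝ) ≤ N + 1 := by linarith
          _ = b / 2 * ((N + 1) * (2 / b)) := by field_simp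
          _ ≤ b / 2 * #(C y.succ) := by gcongr; exact hCr _
          _ ≤ _ := hC'c y
      exact_mod_cast this
    obtain ⟨f, hf, hfC, hfH⟩ := ih V G h (by omega) (H.comap Fin.succ) C' hC'N
      fun x y hxy => (hH _ _ hxy).mono_subset (min_le_left _ _) hα.le (hC's x) (hC's y)
        (hC'c x) (hC'c y)
    have hadj : ∀ y : Fin h, H.Adj 0 y.succ → G.Adj v (f y) := fun y hy => by
      have := mem_of_mem_erase (hfC y)
      rw [if_pos hy] at this
      exact (mem_filter.1 this).2
    refine ⟨Fin.cons v f, ?_, ?_, ?_⟩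
    · rw [Fin.cons_injective_iff]
      refine ⟨?_, hf⟩
      rintro ⟨y, hy⟩
      exact ne_of_mem_erase (hfC y) hy
    · intro x
      refine Fin.cases ?_ (fun y => ?_) x
      · simpa using hv
      · simpa using hC's y (hfC y)
    · intro x y
      refine Fin.cases ?_ (fun x => ?_) x <;> refine Fin.cases ?_ (fun y => ?_) y
      · simp
      · simpa using hadj y
      · intro hxy
        simpa using (hadj x hxy.symm).symm
      · simpa using hfH x y

/-! ### Sparse boxes by deleting edges of the pattern -/

/-- Every large box contains a large sub-box on which `G` is sparse between the classes that are
not adjacent in some graph `R'`, while `G` contains all small graphs that map to `R'`. -/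
theorem exists_sparse_box {β : ℝ} (hβ : 0 < β) (k M r : ℕ) :
    ∃ c : ℝ, 0 < c ∧ c ≤ 1 ∧ ∃ b : ℝ, 0 < b ∧ b ≤ 1 ∧ b ≤ β ∧ ∃ N : ℕ,
      ∀ (V : Type*) (G : SimpleGraph V) (U : Fin k → Finset V) (R : SimpleGraph (Fin k)),
        R.edgeSet.ncard ≤ r → (∀ i, N ≤ #(U i)) →
        (∀ i j, i ≠ j → ¬ R.Adj i j → (crossing G (U i) (U j) : ℝ) ≤ b * (#(U i) * #(U j))) →
        ∃ (U' : Fin k → Finset V) (R' : SimpleGraph (Fin k)), (∀ i, U' i ⊆ U i) ∧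
          (∀ i, c * #(U i) ≤ (#(U' i) : ℝ)) ∧
          (∀ i j, i ≠ j → ¬ R'.Adj i j →
            (crossing G (U' i) (U' j) : ℝ) ≤ β * (#(U' i) * #(U' j))) ∧
          ∀ h ≤ M, ∀ H : SimpleGraph (Fin h), Nonempty (H →g R') → H.IsContained G := by
  classical
  induction r with
  | zero =>
    -- The pattern has no edges, so only edgeless graphs map to it and the density requirement is
    -- vacuous.
    obtain ⟨α, hα, hα1, N, hN⟩ := exists_embedding one_pos le_rfl M
    refine ⟨1, one_pos, le_rfl, min β 1, by positivity, min_le_right _ _, min_le_left _ _, N,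
      fun V G U R hR hU hs => ⟨U, R, fun i => subset_rfl, fun i => by simp, ?_, ?_⟩⟩
    · intro i j hij hR'
      refine (hs i j hij hR').trans ?_
      gcongr
      exact min_le_left _ _
    · rintro h hh H ⟨φ⟩
      have hR0 : R.edgeSet = ∅ := (Set.ncard_eq_zero (Set.toFinite _)).1 (by omega)
      obtain ⟨f, hf, -, hfa⟩ := hN V G h hh H (fun x => U (φ x)) (fun x => hU _)
        fun x y hxy => absurd (R.mem_edgeSet.2 (φ.map_adj hxy)) (by simp [hR0])
      exact ⟨⟨⟨f, fun {x y} => hfa x y⟩, hf⟩⟩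
  | succ r ih =>
    obtain ⟨c, hc, hc1, b, hb, hb1, hbβ, N, ih⟩ := ih
    obtain ⟨α, hα, hα1, N', hN'⟩ := exists_embedding hb hb1 M
    have hαα : α * α ≤ 1 := by nlinarith
    -- Shrinking both sides by a factor `α` multiplies a density by at most `α⁻²`; starting from `b
    -- * (α * α)`, old non-edges remain `b`-sparse as the induction needs.
    refine ⟨c * α, by positivity, by nlinarith, b * (α * α), by positivity, by nlinarith,
      by nlinarith, max N' ⌈N / α⌉₊, fun V G U R hR hU hs => ?_⟩
    by_cases hd : ∀ i j, R.Adj i j → LowerDense G α b (U i) (U j)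
    · refine ⟨U, R, fun i => subset_rfl, fun i => ?_, ?_, ?_⟩
      · have : c * α ≤ 1 := by nlinarith
        nlinarith [(Nat.cast_nonneg #(U i) : (0 : ℝ) ≤ #(U i))]
      · intro i j hij hR'
        refine (hs i j hij hR').trans ?_
        gcongr
        nlinarith
      · rintro h hh H ⟨φ⟩
        obtain ⟨f, hf, -, hfa⟩ := hN' V G h hh H (fun x => U (φ x))
          (fun x => (le_max_left _ _).trans (hU _)) fun x y hxy => hd _ _ (φ.map_adj hxy)
        exact ⟨⟨⟨f, fun {x y} => hfa x y⟩, hf⟩⟩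
    · simp only [LowerDense] at hd
      push Not at hd
      obtain ⟨i, j, hij, X, hX, Y, hY, hXc, hYc, hXY⟩ := hd
      have hne : i ≠ j := hij.ne
      set U₂ := Function.update (Function.update U i X) j Y with hU₂
      have hi : U₂ i = X := by simp [hU₂, hne]
      have hj : U₂ j = Y := by simp [hU₂]
      have ho : ∀ l, l ≠ i → l ≠ j → U₂ l = U l := fun l h1 h2 => by simp [hU₂, h1, h2]
      have hsub : ∀ l, U₂ l ⊆ U l := fun l => by
        by_cases h2 : l = j
        · subst h2; rwa [hj]
        by_cases h1 : l = i
        · subst h1; rwa [hi]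
        rw [ho l h1 h2]
      have hcard : ∀ l, α * #(U l) ≤ (#(U₂ l) : ℝ) := fun l => by
        by_cases h2 : l = j
        · subst h2; rwa [hj]
        by_cases h1 : l = i
        · subst h1; rwa [hi]
        rw [ho l h1 h2]
        nlinarith [(Nat.cast_nonneg #(U l) : (0 : ℝ) ≤ #(U l))]
      have hR₂ : (R.deleteEdges {s(i, j)}).edgeSet.ncard ≤ r := by
        rw [SimpleGraph.edgeSet_deleteEdges]
        have := Set.ncard_sdiff_singleton_lt_of_mem (R.mem_edgeSet.2 hij) (Set.toFinite _)
        omega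
      have hN₂ : ∀ l, N ≤ #(U₂ l) := by
        intro l
        have : (N : ℝ) ≤ #(U₂ l) := by
          calc (N : ℝ) = α * (N / α) := by field_simp
            _ ≤ α * #(U l) := by
              gcongr
              refine (Nat.le_ceil _).trans ?_
              exact_mod_cast (le_max_right _ _).trans (hU l)
            _ ≤ _ := hcard l
        exact_mod_cast this
      have hs₂ : ∀ l l', l ≠ l' → ¬ (R.deleteEdges {s(i, j)}).Adj l l' →
          (crossing G (U₂ l) (U₂ l') : ℝ) ≤ b * (#(U₂ l) * #(U₂ l')) := by
        intro l l' hll hR'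
        rw [SimpleGraph.deleteEdges_adj] at hR'
        by_cases hRl : R.Adj l l'
        · have : s(l, l') = s(i, j) := by
            by_contra hn
            exact hR' ⟨hRl, by simpa using hn⟩
          rcases Sym2.eq_iff.1 this with ⟨rfl, rfl⟩ | ⟨rfl, rfl⟩
          · rw [hi, hj]
            exact hXY.le
          · rw [hi, hj, crossing_comm, mul_comm (#Y : ℝ)]
            exact hXY.le
        · calc (crossing G (U₂ l) (U₂ l') : ℝ) ≤ crossing G (U l) (U l') := by
                exact_mod_cast crossing_mono G (hsub l) (hsub l')
            _ ≤ b * (α * α) * (#(U l) * #(U l')) := hs l l' hll hRl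
            _ = b * ((α * #(U l)) * (α * #(U l'))) := by ring
            _ ≤ _ := by gcongr <;> exact hcard _
      obtain ⟨U', R', h1, h2, h3, h4⟩ := ih V G U₂ (R.deleteEdges {s(i, j)}) hR₂ hN₂ hs₂
      refine ⟨U', R', fun l => (h1 l).trans (hsub l), fun l => ?_, h3, h4⟩
      calc c * α * #(U l) = c * (α * #(U l)) := by ring
        _ ≤ c * #(U₂ l) := by gcongr; exact hcard l
        _ ≤ _ := h2 l

/-! ### Averaging over recursive box decompositions -/

/-- If every large box has a sub-box of large relative size on which `g` has nonnegative sum, then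
the sum of `g` over a large box is almost nonnegative. -/
theorem le_sum_piFinset_of_exists_box {k : ℕ} {V : Type*} (g : (Fin k → V) → ℝ) {K c s : ℝ}
    (hK : 0 ≤ K) (hc : 0 < c) (hc2 : c ≤ 1 / 2) (hg : ∀ v, -K ≤ g v) {B : Fin k → Finset V}
    (hgood : ∀ U : Fin k → Finset V, (∀ i, U i ⊆ B i) → (∀ i, s ≤ #(U i)) →
      ∃ U' : Fin k → Finset V, (∀ i, U' i ⊆ U i) ∧ (∀ i, c * #(U i) ≤ (#(U' i) : ℝ)) ∧
        (∀ i, (#(U' i) : ℝ) ≤ #(U i) / 2) ∧ 0 ≤ ∑ v ∈ Fintype.piFinset U', g v)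
    (t : ℕ) : ∀ U : Fin k → Finset V, (∀ i, U i ⊆ B i) → (∀ i, s ≤ c ^ t * #(U i)) →
      -(K * (1 - c ^ k) ^ t * ∏ i, (#(U i) : ℝ)) ≤ ∑ v ∈ Fintype.piFinset U, g v := by
  classical
  have hρ : (0 : ℝ) ≤ 1 - c ^ k := by
    have : c ^ k ≤ 1 := pow_le_one₀ hc.le (by linarith)
    linarith
  induction t with
  | zero =>
    intro U _ _
    have := card_nsmul_le_sum (Fintype.piFinset U) g (-K) fun v _ => hg v
    rw [Fintype.card_piFinset, nsmul_eq_mul] at this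
    push_cast at this
    linarith
  | succ t ih =>
    intro U hUB hUs
    obtain ⟨U', hsub, hlow, hup, hsum⟩ := hgood U hUB fun i => (hUs i).trans <| by
      have : c ^ (t + 1) ≤ 1 := pow_le_one₀ hc.le (by linarith)
      nlinarith [(Nat.cast_nonneg #(U i) : (0 : ℝ) ≤ #(U i))]
    -- Transversals are sorted by the set `S` of coordinates falling in `U'`; `S = univ` is the good
    -- sub-box.
    let Q : Finset (Fin k) → Fin k → Finset V := fun S i => if i ∈ S then U' i else U i \ U' i
    have hfib : ∀ S, {v ∈ Fintype.piFinset U | ({i | v i ∈ U' i} : Finset (Fin k)) = S} =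
        Fintype.piFinset (Q S) := by
      intro S
      ext v
      simp only [mem_filter, Fintype.mem_piFinset, Q]
      constructor
      · rintro ⟨hv, rfl⟩ i
        by_cases hi : v i ∈ U' i
        · simp [hi]
        · simp [hi, hv i]
      · intro hv
        refine ⟨fun i => ?_, ?_⟩
        · have := hv i
          split_ifs at this
          · exact hsub i this
          · exact (mem_sdiff.1 this).1
        · ext i
          have := hv i
          split_ifs at this with hi
          · simp [hi, this]
          · simp [hi, (mem_sdiff.1 this).2]
    have hdec : ∀ f : (Fin k → V) → ℝ, ∑ v ∈ Fintype.piFinset U, f v =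
        ∑ v ∈ Fintype.piFinset U', f v +
          ∑ S ∈ univ.erase (univ : Finset (Fin k)), ∑ v ∈ Fintype.piFinset (Q S), f v := by
      intro f
      rw [← sum_fiberwise (Fintype.piFinset U) (fun v => ({i | v i ∈ U' i} : Finset (Fin k))) f,
        ← add_sum_erase _ _ (mem_univ (univ : Finset (Fin k)))]
      simp_rw [hfib]
      congr 1
      simp [Q]
    have hQ : ∀ S, -(K * (1 - c ^ k) ^ t * ∏ i, (#(Q S i) : ℝ)) ≤
        ∑ v ∈ Fintype.piFinset (Q S), g v := by
      intro S
      refine ih (Q S) (fun i => ?_) (fun i => ?_)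
      · refine Subset.trans ?_ (hUB i)
        simp only [Q]
        split_ifs
        · exact hsub i
        · exact sdiff_subset
      -- The upper bound of one half on `U'` is what keeps the complements large enough for the
      -- recursion.
      · have : c * #(U i) ≤ (#(Q S i) : ℝ) := by
          simp only [Q]
          split_ifs
          · exact hlow i
          · rw [cast_card_sdiff (hsub i)]
            nlinarith [hup i, (Nat.cast_nonneg #(U i) : (0 : ℝ) ≤ #(U i))]
        calc s ≤ c ^ (t + 1) * #(U i) := hUs i
          _ = c ^ t * (c * #(U i)) := by ring
          _ ≤ _ := by gcongr
    -- The same decomposition applied to the constant `1` shows that the remaining pieces have at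
    -- most a fraction `1 - c ^ k` of the volume.
    have hvol := hdec fun _ => 1
    simp only [sum_const, Fintype.card_piFinset, nsmul_eq_mul, mul_one] at hvol
    push_cast at hvol
    have hprod : c ^ k * ∏ i, (#(U i) : ℝ) ≤ ∏ i, (#(U' i) : ℝ) := by
      calc c ^ k * ∏ i, (#(U i) : ℝ) = ∏ i, (c * #(U i) : ℝ) := by
            rw [prod_mul_distrib]; simp
        _ ≤ _ := prod_le_prod (fun i _ => by positivity) fun i _ => hlow i
    rw [hdec g]
    have hS := sum_le_sum (s := univ.erase (univ : Finset (Fin k))) fun S _ => hQ S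
    rw [sum_neg_distrib, ← mul_sum] at hS
    have hE : (∑ S ∈ univ.erase (univ : Finset (Fin k)), ∏ i, (#(Q S i) : ℝ)) ≤
        (1 - c ^ k) * ∏ i, (#(U i) : ℝ) := by linarith
    have hKρ : 0 ≤ K * (1 - c ^ k) ^ t := by positivity
    have := mul_le_mul_of_nonneg_left hE hKρ
    rw [pow_succ]
    linarith

/-! ### Counting edges through transversals -/

/-- The ordered pairs `i < j` of vertices of the complete graph. -/
def upperPairs (k : ℕ) : Finset (Fin k × Fin k) :=
  univ.filter fun p => p.1 < p.2

theorem mem_upperPairs {k : ℕ} {p : Fin k × Fin k} : p ∈ upperPairs k ↔ p.1 < p.2 := by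
  simp [upperPairs]

theorem card_upperPairs_le (k : ℕ) : (#(upperPairs k) : ℝ) ≤ (k : ℝ) ^ 2 := by
  have h : #(upperPairs k) ≤ k * k := by
    simpa using card_le_univ (upperPairs k)
  rw [sq]
  exact_mod_cast h

-- Each adjacent pair in `U i × U j` extends to a transversal by free choices in the other
-- coordinates. Multiplying through avoids division of naturals.
open Classical in
theorem card_filter_piFinset_adj_mul {k : ℕ} {V : Type*} (Q : SimpleGraph V) (U : Fin k → Finset V)
    {i j : Fin k} (hij : i ≠ j) :
    #{v ∈ Fintype.piFinset U | Q.Adj (v i) (v j)} * (#(U i) * #(U j)) =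
      crossing Q (U i) (U j) * ∏ l, #(U l) := by
  have hmap : ∀ v ∈ ({v ∈ Fintype.piFinset U | Q.Adj (v i) (v j)} : Finset (Fin k → V)),
      (v i, v j) ∈ Q.interedges (U i) (U j) := by
    intro v hv
    rw [mem_filter, Fintype.mem_piFinset] at hv
    exact (SimpleGraph.mem_interedges_iff Q).2 ⟨hv.1 i, hv.1 j, hv.2⟩
  rw [card_eq_sum_card_fiberwise hmap, sum_mul, crossing]
  refine sum_const_nat ?_
  rintro ⟨x, y⟩ hxy
  obtain ⟨hx, hy, hadj⟩ := (SimpleGraph.mem_interedges_iff Q).1 hxy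
  have hfib : ({v ∈ {v ∈ Fintype.piFinset U | Q.Adj (v i) (v j)} | (v i, v j) = (x, y)} :
      Finset (Fin k → V)) =
      Fintype.piFinset (Function.update (Function.update U i {x}) j {y}) := by
    ext v
    simp only [mem_filter, Fintype.mem_piFinset, Prod.mk.injEq]
    constructor
    · rintro ⟨⟨hv, -⟩, rfl, rfl⟩ l
      by_cases hj : l = j
      · subst hj; simp
      by_cases hi : l = i
      · subst hi; simp [hj]
      simpa [hi, hj] using hv l
    · intro hv
      have hvj : v j = y := by simpa using hv j
      have hvi : v i = x := by simpa [hij] using hv i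
      refine ⟨⟨fun l => ?_, by rwa [hvi, hvj]⟩, hvi, hvj⟩
      by_cases hj : l = j
      · subst hj; rwa [hvj]
      by_cases hi : l = i
      · subst hi; rwa [hvi]
      simpa [hi, hj] using hv l
  have hji : j ∈ univ.erase i := by simp [hij.symm]
  rw [hfib, Fintype.card_piFinset, ← mul_prod_erase univ _ (mem_univ i),
    ← mul_prod_erase (univ.erase i) _ hji, ← mul_prod_erase univ (fun l => #(U l)) (mem_univ i),
    ← mul_prod_erase (univ.erase i) (fun l => #(U l)) hji]
  have hrest : ∏ l ∈ (univ.erase i).erase j,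
      #(Function.update (Function.update U i {x}) j {y} l) =
      ∏ l ∈ (univ.erase i).erase j, #(U l) := by
    refine prod_congr rfl fun l hl => ?_
    simp only [mem_erase] at hl
    simp [hl.1, hl.2.1]
  rw [hrest]
  simp [hij]
  ring

open Classical in
theorem sum_piFinset_card_upperPairs {k : ℕ} {V : Type*} (Q : SimpleGraph V)
    (U : Fin k → Finset V) (hU : ∀ i, 0 < #(U i)) :
    ∑ v ∈ Fintype.piFinset U, (#{p ∈ upperPairs k | Q.Adj (v p.1) (v p.2)} : ℝ) =
      (∑ p ∈ upperPairs k, (crossing Q (U p.1) (U p.2) : ℝ) / (#(U p.1) * #(U p.2))) *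
        ∏ i, (#(U i) : ℝ) := by
  have h1 : ∑ v ∈ Fintype.piFinset U, #{p ∈ upperPairs k | Q.Adj (v p.1) (v p.2)} =
      ∑ p ∈ upperPairs k, #{v ∈ Fintype.piFinset U | Q.Adj (v p.1) (v p.2)} := by
    simp_rw [card_filter]
    exact sum_comm
  rw [← Nat.cast_sum, h1, Nat.cast_sum, sum_mul]
  refine sum_congr rfl fun p hp => ?_
  have h2 := card_filter_piFinset_adj_mul Q U (mem_upperPairs.1 hp).ne
  have hi : (0 : ℝ) < #(U p.1) := by exact_mod_cast hU p.1
  have hj : (0 : ℝ) < #(U p.2) := by exact_mod_cast hU p.2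
  have h3 : (#{v ∈ Fintype.piFinset U | Q.Adj (v p.1) (v p.2)} : ℝ) * (#(U p.1) * #(U p.2)) =
      crossing Q (U p.1) (U p.2) * ∏ l, (#(U l) : ℝ) := by exact_mod_cast h2
  rw [div_mul_eq_mul_div, eq_div_iff (by positivity), h3]

/-! ### Edit distance and homomorphism weight -/

theorem crossing_le_sdiff_add {V : Type*} (G G' : SimpleGraph V) (X Y : Finset V) :
    crossing G X Y ≤ crossing (G \ G') X Y + crossing G' X Y := by
  classical
  unfold crossing
  refine (card_le_card fun p hp => ?_).trans (card_union_le _ _)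
  simp only [mem_union, SimpleGraph.mem_interedges_iff, SimpleGraph.sdiff_adj] at hp ⊢
  tauto

/-- Only deleted edges are counted; the order of the colours selects one orientation of each. -/
theorem sum_crossing_le_editDist {V : Type*} [Fintype V] {k : ℕ} (G G' : SimpleGraph V)
    (c : G.Coloring (Fin k)) :
    ∑ p ∈ upperPairs k, crossing (G \ G') (part c p.1) (part c p.2) ≤ editDist G G' := by
  classical
  let T : Finset (V × V) := {q | c q.1 < c q.2 ∧ (G \ G').Adj q.1 q.2}
  have hT : #T = ∑ p ∈ upperPairs k, crossing (G \ G') (part c p.1) (part c p.2) := by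
    have hmap : ∀ q ∈ T, (c q.1, c q.2) ∈ upperPairs k := fun q hq =>
      mem_upperPairs.2 (mem_filter.1 hq).2.1
    rw [card_eq_sum_card_fiberwise hmap]
    refine sum_congr rfl fun p hp => ?_
    unfold crossing
    congr 1
    ext q
    have hp' := mem_upperPairs.1 hp
    simp only [T, mem_filter, mem_univ, true_and, SimpleGraph.mem_interedges_iff, part,
      Prod.ext_iff]
    constructor
    · rintro ⟨⟨-, h⟩, h1, h2⟩
      exact ⟨h1, h2, h⟩
    · rintro ⟨h1, h2, h⟩
      exact ⟨⟨by rwa [h1, h2], h⟩, h1, h2⟩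
  rw [← hT, editDist, ← Set.ncard_coe_finset]
  refine Set.ncard_le_ncard_of_injOn (fun q => s(q.1, q.2)) ?_ ?_ (Set.toFinite _)
  · intro q hq
    have hq' := (mem_filter.1 hq).2.2
    rw [SimpleGraph.sdiff_adj] at hq'
    exact Or.inl ⟨hq'.1, hq'.2⟩
  · intro q hq q' hq' h
    have h1 := (mem_filter.1 hq).2.1
    have h2 := (mem_filter.1 hq').2.1
    rcases Sym2.eq_iff.1 h with ⟨h3, h4⟩ | ⟨h3, h4⟩
    · exact Prod.ext h3 h4
    · rw [h3, h4] at h1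
      exact absurd h1 h2.asymm

theorem homWeight_le_of_homFree (F : GraphFamily) {k : ℕ} (W : WeightedCompleteGraph k)
    {R : SimpleGraph (Fin k)} (hR : HomFree F R) [DecidableRel R.Adj] :
    homWeight F W ≤ ENNReal.ofReal (∑ p ∈ upperPairs k with ¬ R.Adj p.1 p.2,
      W.weight s(p.1, p.2)) := by
  classical
  set S : Finset (Sym2 (Fin k)) :=
    {p ∈ upperPairs k | ¬ R.Adj p.1 p.2}.image fun p => s(p.1, p.2) with hS
  have hmem : ∀ i j, s(i, j) ∈ S ↔ i ≠ j ∧ ¬ R.Adj i j := by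
    intro i j
    simp only [hS, mem_image, mem_filter, mem_upperPairs, Prod.exists]
    constructor
    · rintro ⟨a, b, ⟨hab, hR⟩, h⟩
      rcases Sym2.eq_iff.1 h with ⟨rfl, rfl⟩ | ⟨rfl, rfl⟩
      · exact ⟨hab.ne, hR⟩
      · exact ⟨hab.ne', fun h => hR h.symm⟩
    · rintro ⟨hne, hR⟩
      rcases lt_or_gt_of_ne hne with h | h
      · exact ⟨i, j, ⟨h, hR⟩, rfl⟩
      · exact ⟨j, i, ⟨h, fun h => hR h.symm⟩, Sym2.eq_swap⟩
  have hdel : (⊤ : SimpleGraph (Fin k)).deleteEdges (S : Set (Sym2 (Fin k))) = R := by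
    ext i j
    rw [SimpleGraph.deleteEdges_adj, mem_coe, hmem, SimpleGraph.top_adj]
    constructor
    · rintro ⟨h1, h2⟩
      by_contra h
      exact h2 ⟨h1, h⟩
    · exact fun h => ⟨h.ne, fun h' => h'.2 h⟩
  have hsub : (S : Set (Sym2 (Fin k))) ⊆ (⊤ : SimpleGraph (Fin k)).edgeSet := by
    intro e
    induction e with
    | _ i j =>
      intro he
      exact ((hmem i j).1 he).1
  have hsum : ∑ e ∈ S, W.weight e =
      ∑ p ∈ upperPairs k with ¬ R.Adj p.1 p.2, W.weight s(p.1, p.2) := by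
    rw [hS, sum_image]
    intro p hp q hq h
    have h1 := mem_upperPairs.1 (mem_filter.1 hp).1
    have h2 := mem_upperPairs.1 (mem_filter.1 hq).1
    rcases Sym2.eq_iff.1 h with ⟨h3, h4⟩ | ⟨h3, h4⟩
    · exact Prod.ext h3 h4
    · rw [h3, h4] at h1
      exact absurd h1 h2.asymm
  rw [← hsum]
  refine iInf_le_of_le S (iInf_le_of_le hsub (iInf_le_of_le ?_ le_rfl))
  rwa [hdel]

theorem WeightedCompleteGraph.weight_mem_of_lt {k : ℕ} (W : WeightedCompleteGraph k) {i j : Fin k}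
    (h : i < j) : W.weight s(i, j) ∈ Set.Icc (0 : ℝ) 1 :=
  W.weight_mem _ (by simpa using h.ne)

/-! ### Sparse boxes in family-free graphs -/

/-- There is a common bound for the sizes of members of `F` witnessing that a graph on `k` vertices
is not `F`-homomorphism-free. -/
theorem exists_card_bound_of_not_homFree (F : GraphFamily) (k : ℕ) :
    ∃ M, ∀ R : SimpleGraph (Fin k), ¬ HomFree F R → ∃ H ∈ F, H.1 ≤ M ∧ Nonempty (H.2 →g R) := by
  have h : ∀ R : SimpleGraph (Fin k), ∃ m, ¬ HomFree F R →
      ∃ H ∈ F, H.1 ≤ m ∧ Nonempty (H.2 →g R) := by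
    intro R
    by_cases hR : HomFree F R
    · exact ⟨0, fun h => absurd hR h⟩
    · have hR' := hR
      simp only [HomFree] at hR'
      push Not at hR'
      obtain ⟨H, hH, hne⟩ := hR'
      exact ⟨H.1, fun _ => ⟨H, hH, le_rfl, hne⟩⟩
  choose m hm using h
  -- There are finitely many graphs on `Fin k`, so one bound works even for an infinite family.
  obtain ⟨M, hM⟩ := (Set.finite_range m).bddAbove
  refine ⟨M, fun R hR => ?_⟩
  obtain ⟨H, hH, h1, h2⟩ := hm R hR
  exact ⟨H, hH, h1.trans (hM ⟨R, rfl⟩), h2⟩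

/-- With the complete graph as initial pattern the sparsity hypothesis is vacuous; a final pattern
that is not homomorphism-free would force a small member of `F` into `G`. -/
theorem FamilyFree.exists_sparse_box (F : GraphFamily) (k : ℕ) {β : ℝ} (hβ : 0 < β) :
    ∃ c : ℝ, 0 < c ∧ c ≤ 1 / 2 ∧ ∃ N : ℕ, ∀ (V : Type*) (G : SimpleGraph V), FamilyFree F G →
      ∀ U : Fin k → Finset V, (∀ i, N ≤ #(U i)) →
        ∃ (U' : Fin k → Finset V) (R : SimpleGraph (Fin k)), HomFree F R ∧ (∀ i, U' i ⊆ U i) ∧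
          (∀ i, c * #(U i) ≤ (#(U' i) : ℝ)) ∧ (∀ i, (#(U' i) : ℝ) ≤ #(U i) / 2) ∧
          ∀ i j, i ≠ j → ¬ R.Adj i j →
            (crossing G (U' i) (U' j) : ℝ) ≤ β * (#(U' i) * #(U' j)) := by
  obtain ⟨M, hM⟩ := exists_card_bound_of_not_homFree F k
  obtain ⟨c, hc, hc1, b, -, -, -, N, h⟩ :=
    GraphEdit.exists_sparse_box hβ k M (⊤ : SimpleGraph (Fin k)).edgeSet.ncard
  -- The boxes are halved first, and `n ≤ 3 * (n / 2)` for `2 ≤ n` even with rounding.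
  refine ⟨c / 3, by positivity, by linarith, 2 * N + 2, fun V G hG U hU => ?_⟩
  have hhalf : ∀ i, ∃ X ⊆ U i, #X = #(U i) / 2 := fun i =>
    exists_subset_card_eq (Nat.div_le_self _ _)
  choose X hXU hX using hhalf
  obtain ⟨U', R, hU', hcard, hsparse, hcont⟩ := h V G X ⊤ le_rfl
    (fun i => by rw [hX]; have := hU i; omega) fun i j hij hR => absurd hij hR
  refine ⟨U', R, ?_, fun i => (hU' i).trans (hXU i), fun i => ?_, fun i => ?_, hsparse⟩
  · by_contra hR
    obtain ⟨H, hH, hHM, hne⟩ := hM R hR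
    exact hG H hH (hcont _ hHM _ hne)
  · have h3 : #(U i) ≤ 3 * #(X i) := by rw [hX]; have := hU i; omega
    have h3' : (#(U i) : ℝ) ≤ 3 * #(X i) := by exact_mod_cast h3
    calc c / 3 * #(U i) ≤ c / 3 * (3 * #(X i)) := by gcongr
      _ = c * #(X i) := by ring
      _ ≤ _ := hcard i
  · have h2 : 2 * #(U' i) ≤ #(U i) := by
      have := card_le_card (hU' i)
      rw [hX] at this
      omega
    have h2' : 2 * (#(U' i) : ℝ) ≤ #(U i) := by exact_mod_cast h2
    linarith

/-! ### Assembling the lower bound -/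

/-- If every large box has a sub-box of large relative size on which the total density of `Q` is at
least `θ`, then the total density of `Q` on the whole box is almost at least `θ`. -/
theorem le_sum_crossing_of_exists_box {k m : ℕ} {V : Type*} (Q : SimpleGraph V) {K c θ : ℝ}
    (hK : 0 ≤ K) (hc : 0 < c) (hc2 : c ≤ 1 / 2) (hθ : θ ≤ K) (hm : 0 < m) {B : Fin k → Finset V}
    (hB : ∀ i, #(B i) = m) (t : ℕ)
    (hgood : ∀ U : Fin k → Finset V, (∀ i, U i ⊆ B i) → (∀ i, c ^ t * m ≤ #(U i)) →
      ∃ U' : Fin k → Finset V, (∀ i, U' i ⊆ U i) ∧ (∀ i, c * #(U i) ≤ (#(U' i) : ℝ)) ∧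
        (∀ i, (#(U' i) : ℝ) ≤ #(U i) / 2) ∧
        θ ≤ ∑ p ∈ upperPairs k, (crossing Q (U' p.1) (U' p.2) : ℝ) / (#(U' p.1) * #(U' p.2))) :
    (θ - K * (1 - c ^ k) ^ t) * (m : ℝ) ^ 2 ≤
      ∑ p ∈ upperPairs k, (crossing Q (B p.1) (B p.2) : ℝ) := by
  classical
  have hm0 : (0 : ℝ) < m := by exact_mod_cast hm
  -- Over a box with nonempty sides, `g` sums to the volume times the excess of total density over
  -- `θ`.
  let g : (Fin k → V) → ℝ := fun v =>
    (#{p ∈ upperPairs k | Q.Adj (v p.1) (v p.2)} : ℝ) - θ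
  have hgsum : ∀ U : Fin k → Finset V, (∀ i, 0 < #(U i)) → ∑ v ∈ Fintype.piFinset U, g v =
      ((∑ p ∈ upperPairs k, (crossing Q (U p.1) (U p.2) : ℝ) / (#(U p.1) * #(U p.2))) - θ)
        * ∏ i, (#(U i) : ℝ) := by
    intro U hU
    simp only [g]
    rw [sum_sub_distrib, sum_piFinset_card_upperPairs _ _ hU, sum_const, Fintype.card_piFinset,
      nsmul_eq_mul]
    push_cast
    ring
  have hg : ∀ v, -K ≤ g v := by
    intro v
    have h2 : (0 : ℝ) ≤ #{p ∈ upperPairs k | Q.Adj (v p.1) (v p.2)} := Nat.cast_nonneg _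
    simp only [g]
    linarith
  have hmain := le_sum_piFinset_of_exists_box g (s := c ^ t * m) (B := B) hK hc hc2 hg
    (fun U hU hUs => by
      obtain ⟨U', hsub, hlow, hup, hd⟩ := hgood U hU hUs
      refine ⟨U', hsub, hlow, hup, ?_⟩
      have hpos : ∀ i, 0 < #(U' i) := fun i => by
        have h1 : (0 : ℝ) < c * #(U i) :=
          mul_pos hc (lt_of_lt_of_le (by positivity) (hUs i))
        exact_mod_cast h1.trans_le (hlow i)
      rw [hgsum U' hpos]
      exact mul_nonneg (sub_nonneg.2 hd) (prod_nonneg fun _ _ => Nat.cast_nonneg _))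
    t B (fun i => subset_rfl) fun i => by rw [hB]
  rw [hgsum _ fun i => by rwa [hB]] at hmain
  simp only [hB, prod_const, card_univ, Fintype.card_fin] at hmain
  rw [← sum_div, ← neg_mul] at hmain
  have h1 := le_of_mul_le_mul_right hmain (by positivity)
  have h4 : θ - K * (1 - c ^ k) ^ t ≤
      (∑ p ∈ upperPairs k, (crossing Q (B p.1) (B p.2) : ℝ)) / (m * m) := by
    linarith
  rw [le_div_iff₀ (by positivity)] at h4
  rwa [sq (m : ℝ)]

/-- The real-valued form of the key lemma, for a fixed `F`-free graph `G'`. -/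
theorem exists_regularity_threshold (F : GraphFamily) (k : ℕ) {ε : ℝ} (hε : 0 < ε) :
    ∃ (N : ℕ) (γ : ℝ), 0 < γ ∧ 0 < N ∧
      ∀ (W : WeightedCompleteGraph k) (V : Type*) [Fintype V] (G : SimpleGraph V)
        (c : G.Coloring (Fin k)) (m : ℕ), (∀ i, #(part c i) = m) → N ≤ m →
        (∀ i j, i < j → IsRegularPair G γ (part c i) (part c j)) →
        (∀ i j, i < j → density G (part c i) (part c j) = W.weight s(i, j)) →
        ∀ G' : SimpleGraph V, FamilyFree F G' →
          (∃ R : SimpleGraph (Fin k), HomFree F R) ∧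
          ∀ θ : ℝ, (∀ (R : SimpleGraph (Fin k)) [DecidableRel R.Adj], HomFree F R →
            θ ≤ ∑ p ∈ upperPairs k with ¬ R.Adj p.1 p.2, W.weight s(p.1, p.2)) →
            (θ - ε * (k : ℝ) ^ 2) * (m : ℝ) ^ 2 ≤ editDist G G' := by
  classical
  obtain ⟨c₀, hc, hc2, N₀, hbox⟩ := FamilyFree.exists_sparse_box F k (β := ε / 4) (by positivity)
  have hck : 0 < c₀ ^ k := by positivity
  have hck1 : c₀ ^ k ≤ 1 := pow_le_one₀ hc.le (by linarith)
  obtain ⟨t, ht⟩ := exists_pow_lt_of_lt_one (half_pos hε) (by linarith : 1 - c₀ ^ k < 1)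
  have hct1 : c₀ ^ t ≤ 1 := pow_le_one₀ hc.le (by linarith)
  -- Regularity is tested on sets of relative size at least `c₀ ^ (t + 1)`. Its error `ε / 4` and
  -- the sparsity `ε / 4` cost `ε / 2` per pair; the uncovered volume costs the other `ε / 2 * k ^
  -- 2`.
  refine ⟨⌈(N₀ + 1) / c₀ ^ t⌉₊ + 1, min (ε / 4) (c₀ ^ (t + 1)), by positivity, by omega, ?_⟩
  set γ := min (ε / 4) (c₀ ^ (t + 1)) with hγ
  intro W V _ G c m hm hN hreg hdens G' hG'
  have hmN : (N₀ : ℝ) + 1 ≤ c₀ ^ t * m := by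
    have h1 : ((⌈((N₀ : ℝ) + 1) / c₀ ^ t⌉₊ + 1 : ℕ) : ℝ) ≤ m := by exact_mod_cast hN
    push_cast at h1
    calc (N₀ : ℝ) + 1 = c₀ ^ t * ((N₀ + 1) / c₀ ^ t) := by field_simp
      _ ≤ _ := by
        gcongr
        linarith [Nat.le_ceil (((N₀ : ℝ) + 1) / c₀ ^ t)]
  have hm0 : (0 : ℝ) < m := by
    have h1 : 0 < m := by omega
    exact_mod_cast h1
  have hmN' : (N₀ : ℝ) ≤ m := by nlinarith
  have hex : ∃ R : SimpleGraph (Fin k), HomFree F R := by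
    obtain ⟨-, R, hR, -⟩ := hbox V G' hG' (part c) fun i => by
      rw [hm]; exact_mod_cast hmN'
    exact ⟨R, hR⟩
  refine ⟨hex, fun θ hθ => ?_⟩
  have hθk : θ ≤ (k : ℝ) ^ 2 := by
    obtain ⟨R, hR⟩ := hex
    refine (hθ R hR).trans ?_
    calc ∑ p ∈ upperPairs k with ¬ R.Adj p.1 p.2, W.weight s(p.1, p.2)
        ≤ ∑ p ∈ upperPairs k with ¬ R.Adj p.1 p.2, (1 : ℝ) := by
          refine sum_le_sum fun p hp => ?_
          exact (W.weight_mem_of_lt (mem_upperPairs.1 (mem_filter.1 hp).1)).2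
      _ ≤ ∑ p ∈ upperPairs k, (1 : ℝ) :=
          sum_le_sum_of_subset_of_nonneg (filter_subset _ _) fun _ _ _ => zero_le_one
      _ = #(upperPairs k) := by simp
      _ ≤ _ := card_upperPairs_le k
  set θ' := θ - ε / 2 * (k : ℝ) ^ 2 with hθ'
  obtain ⟨Q, hQ⟩ : ∃ Q, Q = G \ G' := ⟨_, rfl⟩
  have hQd := sum_crossing_le_editDist G G' c
  have hQc := crossing_le_sdiff_add G G'
  rw [← hQ] at hQd hQc
  have hmain := le_sum_crossing_of_exists_box Q (K := (k : ℝ) ^ 2) (θ := θ') (by positivity) hc hc2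
    (by linarith [(by positivity : 0 ≤ ε / 2 * (k : ℝ) ^ 2)]) (by omega) hm t ?_
  · have h2 : (∑ p ∈ upperPairs k, (crossing Q (part c p.1) (part c p.2) : ℝ)) ≤
        editDist G G' := by exact_mod_cast hQd
    have h3 : (k : ℝ) ^ 2 * (1 - c₀ ^ k) ^ t ≤ (k : ℝ) ^ 2 * (ε / 2) := by gcongr
    exact (mul_le_mul_of_nonneg_right (by linarith) (sq_nonneg _)).trans (hmain.trans h2)
  · intro U hU hUs
    obtain ⟨U', R, hR, hsub, hlow, hup, hsp⟩ := hbox V G' hG' U fun i => by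
      have : (N₀ : ℝ) ≤ #(U i) := by linarith [hUs i]
      exact_mod_cast this
    have hU's : ∀ i, c₀ ^ (t + 1) * m ≤ #(U' i) := fun i => by
      calc c₀ ^ (t + 1) * m = c₀ * (c₀ ^ t * m) := by ring
        _ ≤ c₀ * #(U i) := by gcongr; exact hUs i
        _ ≤ _ := hlow i
    have hpos' : ∀ i, (0 : ℝ) < #(U' i) := fun i => lt_of_lt_of_le (by positivity) (hU's i)
    refine ⟨U', hsub, hlow, hup, ?_⟩
    have hγU : ∀ i, γ * #(part c i) ≤ (#(U' i) : ℝ) := fun i => by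
      rw [hm]
      exact (mul_le_mul_of_nonneg_right (min_le_right _ _) hm0.le).trans (hU's i)
    have hd : ∀ p ∈ ({p ∈ upperPairs k | ¬ R.Adj p.1 p.2} : Finset (Fin k × Fin k)),
        W.weight s(p.1, p.2) - ε / 2 ≤
          (crossing Q (U' p.1) (U' p.2) : ℝ) / (#(U' p.1) * #(U' p.2)) := by
      intro p hp
      obtain ⟨hp, hRp⟩ := mem_filter.1 hp
      have hlt := mem_upperPairs.1 hp
      have h1 := hreg _ _ hlt (U' p.1) ((hsub _).trans (hU _)) (U' p.2) ((hsub _).trans (hU _))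
        (hγU _) (hγU _)
      rw [hdens _ _ hlt, density_eq_crossing_div] at h1
      have h2 := (abs_le.1 h1).1
      have h3 : (crossing G (U' p.1) (U' p.2) : ℝ) ≤
          crossing Q (U' p.1) (U' p.2) + crossing G' (U' p.1) (U' p.2) := by
        exact_mod_cast hQc _ _
      have h4 := hsp _ _ hlt.ne hRp
      have hpp : (0 : ℝ) < #(U' p.1) * #(U' p.2) := mul_pos (hpos' _) (hpos' _)
      rw [← div_le_iff₀ hpp] at h4
      have h5 := div_le_div_of_nonneg_right h3 hpp.le
      rw [add_div] at h5
      have h6 : γ ≤ ε / 4 := min_le_left _ _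
      linarith
    have hnum : (#{p ∈ upperPairs k | ¬ R.Adj p.1 p.2} : ℝ) ≤ (k : ℝ) ^ 2 :=
      le_trans (by exact_mod_cast card_filter_le _ _) (card_upperPairs_le k)
    calc θ' ≤ (∑ p ∈ upperPairs k with ¬ R.Adj p.1 p.2, W.weight s(p.1, p.2)) -
          #{p ∈ upperPairs k | ¬ R.Adj p.1 p.2} * (ε / 2) := by
          have := hθ R hR
          nlinarith
      _ = ∑ p ∈ upperPairs k with ¬ R.Adj p.1 p.2, (W.weight s(p.1, p.2) - ε / 2) := by
          rw [sum_sub_distrib, sum_const, nsmul_eq_mul]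
      _ ≤ ∑ p ∈ upperPairs k with ¬ R.Adj p.1 p.2,
          (crossing Q (U' p.1) (U' p.2) : ℝ) / (#(U' p.1) * #(U' p.2)) := sum_le_sum hd
      _ ≤ _ := sum_le_sum_of_subset_of_nonneg (filter_subset _ _) fun _ _ _ => by positivity

theorem card_eq_mul_of_card_part {V : Type*} [Fintype V] {G : SimpleGraph V} {k m : ℕ}
    (c : G.Coloring (Fin k)) (hm : ∀ i, #(part c i) = m) : Fintype.card V = k * m := by
  classical
  rw [← card_univ, card_eq_sum_card_fiberwise (f := c) (t := univ) fun _ _ => mem_univ _]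
  have h : ∀ i, #{v | c v = i} = m := hm
  simp [h]

/-- The real bound is applied with `θ` the minimum weight itself and divided by `(k * m) ^ 2`. The
existence of `R` makes that minimum finite, so `toReal` loses nothing. -/
theorem familyH_le_of_homWeight_bound (F : GraphFamily) {k : ℕ} (hk : 1 ≤ k)
    (W : WeightedCompleteGraph k) {ε : ℝ} (hε : 0 < ε) {m d : ℕ} (hm : 0 < m)
    (hex : ∃ R : SimpleGraph (Fin k), HomFree F R)
    (h : ∀ θ : ℝ, (∀ (R : SimpleGraph (Fin k)) [DecidableRel R.Adj], HomFree F R →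
      θ ≤ ∑ p ∈ upperPairs k with ¬ R.Adj p.1 p.2, W.weight s(p.1, p.2)) →
      (θ - ε * (k : ℝ) ^ 2) * (m : ℝ) ^ 2 ≤ d) :
    familyH F W ≤ (d : ℝ≥0∞) / ((k * m : ℕ) : ℝ≥0∞) ^ 2 + ENNReal.ofReal ε := by
  classical
  have hk0 : (0 : ℝ) < k := by exact_mod_cast hk
  have hm0 : (0 : ℝ) < m := by exact_mod_cast hm
  have hfin : homWeight F W ≠ ∞ := by
    obtain ⟨R, hR⟩ := hex
    exact ne_top_of_le_ne_top ENNReal.ofReal_ne_top (homWeight_le_of_homFree F W hR)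
  have h1 := h (homWeight F W).toReal fun R _ hR =>
    ENNReal.toReal_le_of_le_ofReal (sum_nonneg fun p hp =>
      (W.weight_mem_of_lt (mem_upperPairs.1 (mem_filter.1 hp).1)).1)
      (homWeight_le_of_homFree F W hR)
  have h2 : (homWeight F W).toReal / (k : ℝ) ^ 2 ≤ d / ((k * m : ℕ) : ℝ) ^ 2 + ε := by
    push_cast
    rw [div_add' _ _ _ (by positivity), div_le_div_iff₀ (by positivity) (by positivity)]
    have := mul_le_mul_of_nonneg_right h1 (by positivity : (0 : ℝ) ≤ (k : ℝ) ^ 2)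
    nlinarith
  have h3 : familyH F W = ENNReal.ofReal ((homWeight F W).toReal / (k : ℝ) ^ 2) := by
    rw [ENNReal.ofReal_div_of_pos (by positivity), ENNReal.ofReal_toReal hfin,
      ENNReal.ofReal_pow hk0.le, ENNReal.ofReal_natCast, familyH]
  have hkm : (0 : ℝ) < ((k * m : ℕ) : ℝ) := by
    push_cast
    positivity
  have h4 : (d : ℝ≥0∞) / ((k * m : ℕ) : ℝ≥0∞) ^ 2 =
      ENNReal.ofReal ((d : ℝ) / ((k * m : ℕ) : ℝ) ^ 2) := by
    rw [ENNReal.ofReal_div_of_pos (by positivity), ENNReal.ofReal_pow hkm.le,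
      ENNReal.ofReal_natCast, ENNReal.ofReal_natCast]
  rw [h3, h4, ← ENNReal.ofReal_add (by positivity) hε.le]
  exact ENNReal.ofReal_le_ofReal h2

end GraphEdit

theorem lemma3p3 (F : GraphEdit.GraphFamily) :
    ∃ (N : ℕ → ℝ → ℕ) (γ : ℕ → ℝ → ℝ),
      (∀ (k : ℕ) (ε : ℝ), 1 ≤ k → 0 < ε → 0 < γ k ε) ∧
      ∀ (k : ℕ) (ε : ℝ), 1 ≤ k → 0 < ε →
        ∀ (W : GraphEdit.WeightedCompleteGraph k)
          (V : Type*) [Fintype V] (G : SimpleGraph V) (c : G.Coloring (Fin k)) (m : ℕ),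
          (∀ i : Fin k, (GraphEdit.part c i).card = m) →
          N k ε ≤ m →
          (∀ i j : Fin k, i < j →
            GraphEdit.IsRegularPair G (γ k ε) (GraphEdit.part c i) (GraphEdit.part c j)) →
          (∀ i j : Fin k, i < j →
            GraphEdit.density G (GraphEdit.part c i) (GraphEdit.part c j) = W.weight s(i, j)) →
          GraphEdit.familyH F W ≤ GraphEdit.familyE F G + ENNReal.ofReal ε := by
  choose N γ hγ hN h using fun (k : ℕ) (ε : {ε : ℝ // 0 < ε}) =>
    GraphEdit.exists_regularity_threshold F k ε.2
  classical
  refine ⟨fun k ε => if hε : 0 < ε then N k ⟨ε, hε⟩ else 0,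
    fun k ε => if hε : 0 < ε then γ k ⟨ε, hε⟩ else 0, ?_, ?_⟩
  · intro k ε _ hε
    simp only [dif_pos hε]
    exact hγ _ _
  · intro k ε hk hε W V _ G c m hm hmN hreg hdens
    simp only [dif_pos hε] at hmN hreg
    -- This isolates the infimum, so the bound is checked for each `F`-free `G'`; if there is none,
    -- the infimum is `∞`.
    rw [← tsub_le_iff_right]
    refine le_iInf₂ fun G' hG' => ?_
    rw [tsub_le_iff_right, GraphEdit.card_eq_mul_of_card_part c hm]
    obtain ⟨hex, hθ⟩ := h k ⟨ε, hε⟩ W V G c m hm hmN hreg hdens G' hG'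
    exact GraphEdit.familyH_le_of_homWeight_bound F hk W hε ((hN _ _).trans_le hmN) hex hθ
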